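/- Let $k\ge 1$ and let indices be taken in $\mathbb Z_{k+1}=\mathbb Z/(k+1)\mathbb Z$. An affine permutation is a bijection $x:\mathbb Z\to\mathbb Z$ with $x(i+k+1)=x(i)+k+1$ for all $i$ and $\sum_{i=1}^{k+1}x(i)=\binom{k+2}{2}$. For $i\in\mathbb Z_{k+1}$ let $s_i$ be the affine permutation exchanging $m$ and $m+1$ for every integer $m\equiv i$. A reduced word for $x$ is a word $w=(w_1,\dots,w_l)$ of minimal length with $x=s_{w_1}\cdots s_{w_l}$. For $A\subsetneq\mathbb Z_{k+1}$, a word for the cyclically decreasing element $d_A$ is a word in which each element of $A$ occurs exactly once, no other letter occurs, and $j$ stands to the left of $j-1$ whenever $j,j-1\in A$. A cyclically decreasing decomposition of $x$ is a sequence $(A_1,\dots,A_n)$ of proper subsets of $\mathbb Z_{k+1}$ such that, for some choice of words for the $d_{A_i}$, the concatenated word $d_{A_n}\cdots d_{A_1}$ is a reduced word for $x$. It is maximal if its shape $(|A_1|,\dots,|A_n|)$, padded by zeros, is lexicographically maximal among all cyclically decreasing decompositions of $x$. A $k$-code is a function $\alpha:\mathbb Z_{k+1}\to\mathbb Z_{\ge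 0}$ that takes the value $0$ at least once. Its filling has rows $j=0,1,\dots,\max\alpha-1$ (from the bottom up), row $j$ being the set of residues $\{\,i-j : \alpha(i)>j\,\}$. We say that $\alpha$ is the $k$-code of $x$ if its filling, read as a sequence of rows from the bottom up, is a maximal decomposition of $x$. Inserting a residue $p$ into a sequence of rows $A_1,A_2,\dots$ (all but finitely many empty) starts with $p$ at row $j=1$. At row $A_j$ with current residue $p$: * (Inclusion) if $p,p-1\notin A_j$, add $p$ to $A_j$ and stop; * (Bump) if $p\notin A_j$ and $p-1\in A_j$, replace $p-1$ by $p$ in $A_j$ and continue with $p-1$ at row $j+1$; * (Braid) if $p,p-1\in A_j$, leave $A_j$ unchanged and continue with $p-1$ at row $j+1$; * if $p\in A_j$ and $p-1\notin A_j$, the insertion fails. A word $w=(w_1,\dots,w_n)$ is inserted by inserting $w_1,w_2,\dots,w_n$ in turn, starting from the empty $k$-code; it inserts to $P$ if no letter fails and $P$ is the final sequence of nonempty rows. Its recording tableau $Q(w)$ labels the boxes of $P$: when $w_m$ is inserted, the box added by the final inclusion gets the label $m$, and in each bump the new box (residue $p$) takes over the label of the box it replaces (residue $p-1$ in the same row).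 For a $k$-code $\alpha$, let $\mathfrak Q(\alpha)$ be the set of recording tableaux of all words that insert to the filling of $\alpha$. **Theorem.** Let $x$ be an affine permutation. Then $x$ has exactly one $k$-code $\alpha$. Every reduced word for $x$ inserts to the filling of $\alpha$, and $w\mapsto Q(w)$ is a bijection from the set of reduced words for $x$ onto $\mathfrak Q(\alpha)$. -/

import Mathlib

/-! ### Affine permutations and reduced words -/

/-- An affine permutation: a bijection `x` of `ℤ` with `x (i + (k+1)) = x i + (k+1)` and
`x 1 + ⋯ + x (k+1) = (k+2).choose 2`. -/
structure IsAffinePermutation (k : ℕ) (x : Equiv.Perm ℤ) : Prop where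
  sum_window : ∑ i ∈ Finset.Icc (1 : ℤ) (k + 1), x i = ((k + 2).choose 2 : ℤ)
  periodic : ∀ i : ℤ, x (i + (k + 1)) = x i + (k + 1)

/-- The map on integers exchanging `m` and `m + 1` for every `m` in the residue class `i`. -/
def simpleMap (k : ℕ) (i : ZMod (k + 1)) (m : ℤ) : ℤ :=
  if (m : ZMod (k + 1)) = i then m + 1
  else if (m : ZMod (k + 1)) = i + 1 then m - 1
  else m

theorem simpleMap_involutive (k : ℕ) [NeZero k] (i : ZMod (k + 1)) :
    Function.Involutive (simpleMap k i) := by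
  have h1 : (1 : ZMod (k + 1)) ≠ 0 := by
    have : Fact (1 < k + 1) := ⟨by have := NeZero.pos k; omega⟩
    exact one_ne_zero
  intro m
  unfold simpleMap
  by_cases ha : (m : ZMod (k + 1)) = i
  · simp [ha, h1]
  · by_cases hb : (m : ZMod (k + 1)) = i + 1
    · simp [hb, h1]
    · simp [ha, hb]

/-- The simple transposition `s_i`, as a permutation of `ℤ`. -/
def simpleTransposition (k : ℕ) [NeZero k] (i : ZMod (k + 1)) : Equiv.Perm ℤ :=
  (simpleMap_involutive k i).toPerm

/-- The product `s_{w_1} ⋯ s_{w_l}`. -/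
def wordProduct (k : ℕ) [NeZero k] (w : List (ZMod (k + 1))) : Equiv.Perm ℤ :=
  (w.map (simpleTransposition k)).prod

/-- `w` is a word of minimal length among all words with product `x`. -/
def IsReducedWord (k : ℕ) [NeZero k] (x : Equiv.Perm ℤ) (w : List (ZMod (k + 1))) : Prop :=
  wordProduct k w = x ∧
    ∀ v : List (ZMod (k + 1)), wordProduct k v = x → w.length ≤ v.length

/-! ### Cyclically decreasing decompositions -/

/-- `u` is a word for the cyclically decreasing element `d_A`: each element of `A` occurs exactly
once, no other residue occurs, and `j` stands to the left of `j - 1` whenever both are in `A`. -/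
structure IsDecreasingWord {k : ℕ} (A : Finset (ZMod (k + 1))) (u : List (ZMod (k + 1))) :
    Prop where
  nodup : u.Nodup
  toFinset_eq : u.toFinset = A
  decreasing : ∀ j, j ∈ A → j - 1 ∈ A → u.idxOf j < u.idxOf (j - 1)

/-- `x = d_{A_n} ⋯ d_{A_1}` in the nil-Coxeter monoid, for the list `A = [A_1, …, A_n]` of proper
subsets of `ZMod (k + 1)`. A product of generators of that monoid is the nonzero element
corresponding to `x` exactly when its word is a reduced word for `x`. -/
def IsCyclicDecomposition (k : ℕ) [NeZero k] (x : Equiv.Perm ℤ)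
    (A : List (Finset (ZMod (k + 1)))) : Prop :=
  (∀ S ∈ A, S ≠ Finset.univ) ∧
    ∃ u : List (List (ZMod (k + 1))),
      List.Forall₂ IsDecreasingWord A u ∧ IsReducedWord k x u.reverse.flatten

/-- The shape `(|A_1|, …, |A_n|)`, continued by zeros. -/
def shape {k : ℕ} (A : List (Finset (ZMod (k + 1)))) (i : ℕ) : ℕ :=
  (A.getD i ∅).card

/-- `A` is a cyclically decreasing decomposition of `x` of lexicographically maximal shape. -/
def IsMaximalDecomposition (k : ℕ) [NeZero k] (x : Equiv.Perm ℤ)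
    (A : List (Finset (ZMod (k + 1)))) : Prop :=
  IsCyclicDecomposition k x A ∧
    ∀ B, IsCyclicDecomposition k x B → toLex (shape B) ≤ toLex (shape A)

/-! ### `k`-codes -/

/-- A `k`-code: a function from the residues modulo `k + 1` to `ℕ` with at least one zero. -/
@[ext]
structure KCode (k : ℕ) where
  height : ZMod (k + 1) → ℕ
  exists_zero : ∃ i, height i = 0

/-- The rows of the filling of a `k`-code, from the bottom row up: row `j` (counted from `0`)
contains the residue `i - j` for every column `i` with more than `j` boxes. -/
def KCode.filling {k : ℕ} (α : KCode k) : List (Finset (ZMod (k + 1))) :=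
  (List.range (Finset.univ.sup α.height)).map fun j =>
    (Finset.univ.filter fun i => j < α.height i).image fun i => i - (j : ZMod (k + 1))

/-- `α` is the `k`-code of `x`: its filling is a maximal decomposition of `x`. -/
def IsKCodeOf (k : ℕ) [NeZero k] (α : KCode k) (x : Equiv.Perm ℤ) : Prop :=
  IsMaximalDecomposition k x α.filling

/-! ### Insertion and recording -/

/-- A row of a recording tableau: `some m` is the label of the box with the given residue, and
`none` means that the row has no box with that residue. -/
abbrev RecordingRow (k : ℕ) := ZMod (k + 1) → Option ℕ

/-- Insertion of the residue `p`, as the `m`-th letter, into a list of rows (lowest row first), each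
given by its set of residues and its row of labels; the rows above the listed ones are empty. The
value is `none` if the insertion meets a row that contains `p` but not `p - 1`
(that is, a row `A` with `p` a right descent of `d_A`; the product is then zero). -/
def insertResidue {k : ℕ} (m : ℕ) :
    List (Finset (ZMod (k + 1)) × RecordingRow k) → ZMod (k + 1) →
      Option (List (Finset (ZMod (k + 1)) × RecordingRow k))
  | [], p => some [({p}, Function.update (fun _ => none) p (some m))]
  | (A, Q) :: rows, p =>
    if p ∉ A then
      if p - 1 ∉ A then
        -- inclusion
        some ((insert p A, Function.update Q p (some m)) :: rows)
      else
        -- bump move: the box with residue `p - 1` is replaced by one with residue `p`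
        (insertResidue m rows (p - 1)).map fun rows' =>
          (insert p (A.erase (p - 1)),
            Function.update (Function.update Q p (Q (p - 1))) (p - 1) none) :: rows'
    else if p - 1 ∈ A then
      -- braid move
      (insertResidue m rows (p - 1)).map fun rows' => (A, Q) :: rows'
    else none

/-- Insert the letters of a word from left to right, labelling them `m + 1`, `m + 2`, …. -/
def insertLetters {k : ℕ} : ℕ → List (Finset (ZMod (k + 1)) × RecordingRow k) →
    List (ZMod (k + 1)) → Option (List (Finset (ZMod (k + 1)) × RecordingRow k))
  | _, T, [] => some T
  | m, T, p :: w => (insertResidue (m + 1) T p).bind fun T' => insertLetters (m + 1) T' w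

/-- The result of inserting the word `w` into the empty `k`-code: the filling `P` and the recording
tableau `Q`, or `none` if the insertion fails at some letter. -/
def insertWord {k : ℕ} (w : List (ZMod (k + 1))) :
    Option (List (Finset (ZMod (k + 1))) × List (RecordingRow k)) :=
  (insertLetters 0 [] w).map List.unzip

/-- The recording tableau of `w` (the empty tableau if `w` cannot be inserted). -/
def recordingTableau {k : ℕ} (w : List (ZMod (k + 1))) : List (RecordingRow k) :=
  ((insertWord w).map Prod.snd).getD []

/-- The recording tableaux associated to `α`: those of the words that insert to `α`. -/
def recordingTableaux {k : ℕ} (α : KCode k) : Set (List (RecordingRow k)) :=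
  {Q | ∃ w : List (ZMod (k + 1)), insertWord w = some (α.filling, Q)}

/-! ### Insertion on column heights -/

/-! A filling is determined by its column heights `a`, and on heights the insertion of `p` is a
simple rule: it succeeds iff `a p ≤ a (p - 1)`, and then the two heights trade places, the one
arriving at `p` growing by one (`map_insertResidue`).

For an affine permutation, count at each position the larger values to its left. Right
multiplication by `s_p` at an ascent changes these counts by the same rule, and the inequality
detects ascents (`inversionCode_mul_simpleTransposition`, `inversionCode_le_pred_iff`). So a word is
reduced exactly when no letter fails, and it then inserts to the inversion code of its product. The
code shows the descents, hence determines the permutation, and the reduced words for `x` are the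
words inserting to its code (`isReducedWord_iff`).

Reading words of the filling of `a` insert to `a`, so the filling of the inversion code is a
decomposition of `x`, and that of no other `k`-code is. It is maximal: the bottom row of any
decomposition lies in the support of the final heights, and in case of equality that row can be
cancelled (`shape_le_shape_fillingOfHeights`).

The recording tableau allows the last insertion to be undone: the newest label lies in the bottom
row exactly after an inclusion there. Otherwise `p - 1` went up, and bump and braid differ in
whether the row still contains `p - 1` (`insertResidue_injective`). -/

theorem sub_one_ne_self {k : ℕ} [NeZero k] (p : ZMod (k + 1)) : p - 1 ≠ p := by
  have : Fact (1 < k + 1) := ⟨by have := NeZero.pos k; omega⟩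
  intro h
  exact one_ne_zero (sub_eq_self.mp h)

theorem self_ne_add_one {k : ℕ} [NeZero k] (p : ZMod (k + 1)) : p ≠ p + 1 := by
  have := sub_one_ne_self (p + 1)
  rwa [add_sub_cancel_right] at this

/-- The column heights after a successful insertion of the residue `p`. -/
def bumpHeights {k : ℕ} (p : ZMod (k + 1)) (a : ZMod (k + 1) → ℕ) : ZMod (k + 1) → ℕ :=
  Function.update (Function.update a p (a (p - 1) + 1)) (p - 1) (a p)

/-- Insertion of the residue `p` on column heights. -/
def insertHeight {k : ℕ} (a : ZMod (k + 1) → ℕ) (p : ZMod (k + 1)) :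
    Option (ZMod (k + 1) → ℕ) :=
  if a p ≤ a (p - 1) then some (bumpHeights p a) else none

/-- Insertion of a word, from left to right, on column heights. -/
def insertHeights {k : ℕ} : (ZMod (k + 1) → ℕ) → List (ZMod (k + 1)) →
    Option (ZMod (k + 1) → ℕ)
  | a, [] => some a
  | a, p :: w => (insertHeight a p).bind fun b => insertHeights b w

theorem insertHeights_append {k : ℕ} (a : ZMod (k + 1) → ℕ) (v w : List (ZMod (k + 1))) :
    insertHeights a (v ++ w) = (insertHeights a v).bind fun b => insertHeights b w := by
  induction v generalizing a with
  | nil => rfl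
  | cons p v ih => simp [insertHeights, ih, Option.bind_assoc]

theorem insertHeights_concat {k : ℕ} (a : ZMod (k + 1) → ℕ) (v : List (ZMod (k + 1)))
    (p : ZMod (k + 1)) :
    insertHeights a (v ++ [p]) = (insertHeights a v).bind fun b => insertHeight b p := by
  simp [insertHeights_append, insertHeights]

theorem insertHeight_eq_some_iff {k : ℕ} {a b : ZMod (k + 1) → ℕ} {p : ZMod (k + 1)} :
    insertHeight a p = some b ↔ a p ≤ a (p - 1) ∧ bumpHeights p a = b := by
  unfold insertHeight
  split_ifs with h <;> simp [h]

section
variable {k : ℕ} [NeZero k]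

theorem bumpHeights_self (p : ZMod (k + 1)) (a : ZMod (k + 1) → ℕ) :
    bumpHeights p a p = a (p - 1) + 1 := by
  simp [bumpHeights, Function.update_of_ne (sub_one_ne_self p).symm]

omit [NeZero k] in
theorem bumpHeights_pred (p : ZMod (k + 1)) (a : ZMod (k + 1) → ℕ) :
    bumpHeights p a (p - 1) = a p := by
  simp [bumpHeights]

omit [NeZero k] in
theorem bumpHeights_of_ne {p i : ZMod (k + 1)} (a : ZMod (k + 1) → ℕ) (h : i ≠ p)
    (h' : i ≠ p - 1) : bumpHeights p a i = a i := by
  simp [bumpHeights, Function.update_of_ne h, Function.update_of_ne h']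

theorem bumpHeights_injective (p : ZMod (k + 1)) :
    Function.Injective (bumpHeights (k := k) p) := by
  intro a b h
  funext i
  by_cases hi : i = p
  · subst hi
    rw [← bumpHeights_pred i a, h, bumpHeights_pred]
  · by_cases hi' : i = p - 1
    · subst hi'
      have := congrFun h p
      simpa [bumpHeights_self] using this
    · rw [← bumpHeights_of_ne a hi hi', h, bumpHeights_of_ne b hi hi']

/-- Each successful step is invertible, so a common final segment can be cancelled. This drives the
comparison of shapes. -/
theorem insertHeights_injective {a b c : ZMod (k + 1) → ℕ} {w : List (ZMod (k + 1))}
    (ha : insertHeights a w = some c) (hb : insertHeights b w = some c) : a = b := by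
  induction w generalizing a b with
  | nil => simp [insertHeights] at ha hb; rw [ha, hb]
  | cons p w ih =>
    simp only [insertHeights, Option.bind_eq_some_iff] at ha hb
    obtain ⟨a', ha', ha⟩ := ha
    obtain ⟨b', hb', hb⟩ := hb
    obtain rfl := ih ha hb
    rw [insertHeight_eq_some_iff] at ha' hb'
    exact bumpHeights_injective p (ha'.2.trans hb'.2.symm)

theorem sum_bumpHeights (p : ZMod (k + 1)) (a : ZMod (k + 1) → ℕ) :
    ∑ i, bumpHeights p a i = ∑ i, a i + 1 := by
  have hp := sub_one_ne_self p
  have key : ∀ f : ZMod (k + 1) → ℕ,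
      ∑ i, f i = f p + (f (p - 1) + ∑ i ∈ (Finset.univ.erase p).erase (p - 1), f i) := by
    intro f
    rw [Finset.add_sum_erase _ _ (by simp [hp]), Finset.add_sum_erase _ _ (by simp)]
  rw [key, key a, bumpHeights_self, bumpHeights_pred]
  have : ∑ i ∈ (Finset.univ.erase p).erase (p - 1), bumpHeights p a i
      = ∑ i ∈ (Finset.univ.erase p).erase (p - 1), a i := by
    refine Finset.sum_congr rfl fun i hi => ?_
    simp only [Finset.mem_erase, Finset.mem_univ, and_true] at hi
    exact bumpHeights_of_ne a hi.2 hi.1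
  rw [this]
  ring

-- A zero at `p - 1` forces `a p = 0` by the inequality, and this zero moves to `p - 1`. Thus the
-- heights stay those of a `k`-code.
omit [NeZero k] in
theorem exists_bumpHeights_eq_zero {p : ZMod (k + 1)} {a : ZMod (k + 1) → ℕ}
    (h : a p ≤ a (p - 1)) (ha : ∃ i, a i = 0) : ∃ i, bumpHeights p a i = 0 := by
  obtain ⟨i, hi⟩ := ha
  by_cases h1 : i = p
  · exact ⟨p - 1, by rw [bumpHeights_pred, ← h1, hi]⟩
  · by_cases h2 : i = p - 1
    · exact ⟨p - 1, by rw [bumpHeights_pred]; rw [← h2, hi] at h; omega⟩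
    · exact ⟨i, by rw [bumpHeights_of_ne a h1 h2, hi]⟩

omit [NeZero k] in
theorem exists_eq_zero_of_insertHeights {a b : ZMod (k + 1) → ℕ} {w : List (ZMod (k + 1))}
    (h : insertHeights a w = some b) (ha : ∃ i, a i = 0) : ∃ i, b i = 0 := by
  induction w generalizing a with
  | nil => simp [insertHeights] at h; rwa [← h]
  | cons p w ih =>
    simp only [insertHeights, Option.bind_eq_some_iff] at h
    obtain ⟨a', ha', h⟩ := h
    rw [insertHeight_eq_some_iff] at ha'
    exact ih h (ha'.2 ▸ exists_bumpHeights_eq_zero ha'.1 ha)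

/-! ### Heights and cyclically decreasing words -/

/-- The residues of the nonempty columns. -/
def heightSupport {k : ℕ} (a : ZMod (k + 1) → ℕ) : Finset (ZMod (k + 1)) :=
  Finset.univ.filter fun i => 0 < a i

/-- The heights of the filling without its lowest row. -/
def tailHeights {k : ℕ} (a : ZMod (k + 1) → ℕ) (i : ZMod (k + 1)) : ℕ := a (i + 1) - 1

omit [NeZero k] in
theorem mem_heightSupport {a : ZMod (k + 1) → ℕ} {i : ZMod (k + 1)} :
    i ∈ heightSupport a ↔ 0 < a i := by
  simp [heightSupport]

/-- Inserting `i` makes column `i` nonempty, and only a later insertion of `i + 1` could empty it.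
In a decreasing word `i + 1` occurs before `i`, and only once. -/
theorem subset_heightSupport_of_insertHeights {A : Finset (ZMod (k + 1))}
    {u : List (ZMod (k + 1))} (hu : IsDecreasingWord A u) {a b : ZMod (k + 1) → ℕ}
    (h : insertHeights a u = some b) : A ⊆ heightSupport b := by
  have key : ∀ v w c, v ++ w = u → insertHeights a v = some c → ∀ i ∈ v, 0 < c i := by
    intro v
    induction v using List.reverseRecOn with
    | nil => simp
    | append_singleton v p ih =>
      intro w c hvw hc i hi
      rw [insertHeights_concat, Option.bind_eq_some_iff] at hc
      obtain ⟨c', hc', hc⟩ := hc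
      rw [insertHeight_eq_some_iff] at hc
      obtain ⟨hle, rfl⟩ := hc
      by_cases hip : i = p
      · rw [hip, bumpHeights_self]; omega
      · have hiv : i ∈ v := by simpa [hip] using hi
        have := ih (p :: w) c' (by simpa using hvw) hc' i hiv
        by_cases hip' : i = p - 1
        · exfalso
          have hA : ∀ j, j ∈ u ↔ j ∈ A := fun j => by rw [← hu.toFinset_eq, List.mem_toFinset]
          have hlt := hu.decreasing p ((hA p).1 (by simp [← hvw]))
            ((hA _).1 (by rw [← hip', ← hvw]; simp [hiv]))
          have hn := hu.nodup
          rw [← hvw] at hn hlt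
          have hpv : p ∉ v := fun hpv =>
            (List.nodup_append.1 (List.nodup_append.1 hn).1).2.2 p hpv p (by simp) rfl
          rw [← hip', List.append_assoc, List.idxOf_append_of_notMem hpv,
            List.idxOf_append_of_mem hiv] at hlt
          have := List.idxOf_lt_length_of_mem hiv
          omega
        · rwa [bumpHeights_of_ne c' hip hip']
  intro i hi
  rw [mem_heightSupport]
  rw [← hu.toFinset_eq, List.mem_toFinset] at hi
  exact key u [] b (by simp) h i hi

/-- The invariant `key` describes the heights after a prefix: inserted columns are final, a column
vacated by its successor is empty, the others are untouched. -/
theorem insertHeights_tailHeights {a : ZMod (k + 1) → ℕ} {u : List (ZMod (k + 1))}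
    (hu : IsDecreasingWord (heightSupport a) u) :
    insertHeights (tailHeights a) u = some a := by
  have hA : ∀ j, j ∈ u ↔ 0 < a j := fun j => by
    rw [← mem_heightSupport, ← hu.toFinset_eq, List.mem_toFinset]
  have key : ∀ v w, v ++ w = u → insertHeights (tailHeights a) v =
      some fun i => if i ∈ v then a i else if i + 1 ∈ v then 0 else a (i + 1) - 1 := by
    intro v
    induction v using List.reverseRecOn with
    | nil => intro _ _; simp [insertHeights]; rfl
    | append_singleton v p ih =>
      intro w hvw
      rw [insertHeights_concat, ih (p :: w) (by simpa using hvw), Option.bind_some,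
        insertHeight_eq_some_iff]
      have hn := hu.nodup
      rw [← hvw] at hn
      have hpv : p ∉ v := fun hpv =>
        (List.nodup_append.1 (List.nodup_append.1 hn).1).2.2 p hpv p (by simp) rfl
      have hidx : u.idxOf p = v.length := by
        rw [← hvw, List.append_assoc, List.idxOf_append_of_notMem hpv]
        simp
      have hp : 0 < a p := (hA p).1 (by simp [← hvw])
      have hpred : p - 1 ∉ v := by
        intro hv
        have h1 := hu.decreasing p (mem_heightSupport.2 hp)
          (mem_heightSupport.2 ((hA _).1 (by rw [← hvw]; simp [hv])))
        have h2 : u.idxOf (p - 1) < v.length := by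
          rw [← hvw, List.append_assoc, List.idxOf_append_of_mem hv]
          exact List.idxOf_lt_length_of_mem hv
        omega
      have hsucc : p + 1 ∉ v → a (p + 1) = 0 := by
        intro hv
        by_contra h0
        have h1 := hu.decreasing (p + 1) (mem_heightSupport.2 (Nat.pos_of_ne_zero h0))
          (by simpa [mem_heightSupport] using hp)
        rw [add_sub_cancel_right, hidx] at h1
        have h3 : u.idxOf (p + 1) = v.length + (([p] ++ w).idxOf (p + 1)) := by
          rw [← hvw, List.append_assoc, List.idxOf_append_of_notMem hv]
        omega
      -- Column `p` is empty just before `p` is inserted: either `p + 1` has vacated it, or `a (p +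
      -- 1) = 0` and the truncated subtraction gives zero.
      have hz : (if p ∈ v then a p else if p + 1 ∈ v then 0 else a (p + 1) - 1) = 0 := by
        rw [if_neg hpv]
        split_ifs with h
        · rfl
        · rw [hsucc h]
      refine ⟨by rw [hz]; omega, ?_⟩
      funext i
      by_cases hip : i = p
      · subst hip
        rw [bumpHeights_self]
        simp [hpv, hpred]
        omega
      · by_cases hip' : i = p - 1
        · subst hip'
          rw [bumpHeights_pred, hz]
          simp [hpred, hip]
        · rw [bumpHeights_of_ne _ hip hip']
          have : i + 1 ≠ p := fun h => hip' (by rw [← h]; simp)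
          simp [hip, this]
  rw [key u [] (by simp)]
  congr 1
  funext i
  simp only [hA]
  split_ifs <;> omega

-- A proper subset of the cycle has an element `p` with `p + 1 ∉ A`, which can stand first. For the
-- whole cycle the order conditions would be circular.
omit [NeZero k] in
theorem exists_isDecreasingWord (A : Finset (ZMod (k + 1))) (hA : A ≠ Finset.univ) :
    ∃ u, IsDecreasingWord A u := by
  induction A using Finset.strongInduction with
  | H A ih =>
    rcases A.eq_empty_or_nonempty with rfl | ⟨q, hq⟩
    · exact ⟨[], List.nodup_nil, rfl, by simp⟩
    · obtain ⟨p, hp, hp'⟩ : ∃ p ∈ A, p + 1 ∉ A := by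
        by_contra! h
        refine hA (Finset.eq_univ_of_forall fun i => ?_)
        have : ∀ n : ℕ, q + (n : ZMod (k + 1)) ∈ A := by
          intro n
          induction n with
          | zero => simpa using hq
          | succ n ihn => push_cast; rw [← add_assoc]; exact h _ ihn
        simpa using this (i - q).val
      obtain ⟨u, hu⟩ := ih (A.erase p) (Finset.erase_ssubset hp)
        (fun h => by have := Finset.mem_univ p; rw [← h] at this; simp at this)
      refine ⟨p :: u, ?_, ?_, ?_⟩
      · rw [List.nodup_cons]
        refine ⟨fun h => ?_, hu.nodup⟩
        rw [← List.mem_toFinset, hu.toFinset_eq] at h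
        simp at h
      · rw [List.toFinset_cons, hu.toFinset_eq, Finset.insert_erase hp]
      · intro j hj hj'
        have h1 : j - 1 ≠ p := fun h => hp' (by rwa [← h, sub_add_cancel])
        rw [List.idxOf_cons_ne _ h1.symm]
        by_cases hjp : j = p
        · subst hjp
          simp
        · rw [List.idxOf_cons_ne _ (Ne.symm hjp)]
          have := hu.decreasing j (by simp [hjp, hj]) (by simp [h1, hj'])
          omega

end

/-! ### Inversion codes of periodic permutations -/

section
variable {k : ℕ}

/-- The number of integers to the left of `i` at which `x` takes a value larger than `x i`. -/
noncomputable def leftInversions (x : Equiv.Perm ℤ) (i : ℤ) : ℕ :=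
  {j : ℤ | j < i ∧ x i < x j}.ncard

/-- The numbers of left inversions of `x`, as heights of columns indexed by residues. -/
noncomputable def inversionCode (k : ℕ) (x : Equiv.Perm ℤ) (r : ZMod (k + 1)) : ℕ :=
  leftInversions x (r.val + 1)

theorem eq_add_mul_of_intCast_eq {i j : ℤ} (h : (i : ZMod (k + 1)) = j) :
    ∃ n : ℤ, i = j + n * (k + 1) := by
  rw [ZMod.intCast_eq_intCast_iff_dvd_sub] at h
  obtain ⟨n, hn⟩ := h
  refine ⟨-n, ?_⟩
  push_cast at hn
  linarith

theorem intCast_val (r : ZMod (k + 1)) : (((r.val : ℕ) : ℤ) : ZMod (k + 1)) = r := by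
  simp

theorem apply_add_mul {x : Equiv.Perm ℤ} (hx : ∀ i : ℤ, x (i + (k + 1)) = x i + (k + 1))
    (i n : ℤ) : x (i + n * (k + 1)) = x i + n * (k + 1) := by
  induction n using Int.induction_on with
  | zero => simp
  | succ n ih =>
    have := hx (i + n * (k + 1))
    rw [show i + ((n : ℤ) + 1) * (k + 1) = i + n * (k + 1) + (k + 1) by ring, this, ih]
    ring
  | pred n ih =>
    have := hx (i + (-(n : ℤ) - 1) * (k + 1))
    rw [show i + (-(n : ℤ) - 1) * (k + 1) + (k + 1) = i + -(n : ℤ) * (k + 1) by ring, ih] at this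
    linarith

theorem displacement_congr {x : Equiv.Perm ℤ} (hx : ∀ i : ℤ, x (i + (k + 1)) = x i + (k + 1))
    {i j : ℤ} (h : (i : ZMod (k + 1)) = j) : x i - i = x j - j := by
  obtain ⟨n, rfl⟩ := eq_add_mul_of_intCast_eq h
  rw [apply_add_mul hx]
  ring

theorem leftInversions_congr {x : Equiv.Perm ℤ}
    (hx : ∀ i : ℤ, x (i + (k + 1)) = x i + (k + 1)) {i j : ℤ} (h : (i : ZMod (k + 1)) = j) :
    leftInversions x i = leftInversions x j := by
  obtain ⟨n, rfl⟩ := eq_add_mul_of_intCast_eq h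
  unfold leftInversions
  rw [← Set.ncard_image_of_injective {l : ℤ | l < j ∧ x j < x l}
    (add_left_injective (n * ((k : ℤ) + 1)))]
  congr 1
  ext l
  simp only [Set.mem_image, Set.mem_ofPred_eq]
  constructor
  · rintro ⟨h1, h2⟩
    refine ⟨l - n * (k + 1), ⟨by linarith, ?_⟩, by ring⟩
    have := apply_add_mul hx (l - n * (k + 1)) n
    rw [apply_add_mul hx] at h2
    rw [sub_add_cancel] at this
    linarith
  · rintro ⟨m, ⟨h1, h2⟩, rfl⟩
    rw [apply_add_mul hx, apply_add_mul hx]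
    exact ⟨by linarith, by linarith⟩

/-- Column `i` belongs to position `i + 1`. With this offset `s_i`, which swaps positions `i` and `i
+ 1`, affects columns `i - 1` and `i`, as inserting `i` does. -/
theorem inversionCode_intCast {x : Equiv.Perm ℤ}
    (hx : ∀ i : ℤ, x (i + (k + 1)) = x i + (k + 1)) (i : ℤ) :
    inversionCode k x (i : ZMod (k + 1)) = leftInversions x (i + 1) :=
  leftInversions_congr hx (by push_cast [ZMod.natCast_zmod_val]; simp)

/-- The displacement `x j - j` depends only on the residue of `j`, hence is bounded, here by the sum
of all absolute displacements. -/
theorem finite_leftInversions {x : Equiv.Perm ℤ}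
    (hx : ∀ i : ℤ, x (i + (k + 1)) = x i + (k + 1)) (i c : ℤ) :
    {j : ℤ | j < i ∧ c < x j}.Finite := by
  refine (Set.finite_Ioo (c - ∑ r : ZMod (k + 1), |x r.val - r.val|) i).subset ?_
  rintro j ⟨h1, h2⟩
  refine ⟨?_, h1⟩
  have h3 := displacement_congr hx (intCast_val (j : ZMod (k + 1))).symm
  have h4 : |x (j : ZMod (k + 1)).val - (j : ZMod (k + 1)).val|
      ≤ ∑ r : ZMod (k + 1), |x r.val - r.val| :=
    Finset.single_le_sum (f := fun r : ZMod (k + 1) => |x r.val - (r.val : ℤ)|)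
      (fun r _ => abs_nonneg _) (Finset.mem_univ (j : ZMod (k + 1)))
  have h5 := le_abs_self (x (j : ZMod (k + 1)).val - (j : ZMod (k + 1)).val)
  linarith

variable [NeZero k]

/-! ### Right multiplication by a simple transposition -/

theorem simpleTransposition_apply (p : ZMod (k + 1)) (m : ℤ) :
    simpleTransposition k p m = simpleMap k p m := rfl

theorem simpleTransposition_mul_self (p : ZMod (k + 1)) :
    simpleTransposition k p * simpleTransposition k p = 1 := by
  ext m
  exact simpleMap_involutive k p m

omit [NeZero k] in
theorem simpleMap_intCast (i : ℤ) : simpleMap k (i : ZMod (k + 1)) i = i + 1 := by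
  simp [simpleMap]

theorem simpleMap_intCast_add_one (i : ℤ) :
    simpleMap k (i : ZMod (k + 1)) (i + 1) = i := by
  have h := self_ne_add_one (i : ZMod (k + 1))
  have h' : (i : ZMod (k + 1)) + 1 ≠ i := h.symm
  simp only [simpleMap]
  push_cast
  rw [if_neg h', if_pos rfl]
  ring

omit [NeZero k] in
theorem simpleMap_lt_of_lt {p : ZMod (k + 1)} {l j : ℤ} (hj : (j : ZMod (k + 1)) ≠ p + 1)
    (h : l < j) : simpleMap k p l < j := by
  unfold simpleMap
  split_ifs with h1 h2
  · refine lt_of_le_of_ne h ?_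
    rintro rfl
    push_cast at hj
    exact hj (by rw [h1])
  · omega
  · exact h

/-- The half-line below `j` is stable under `s_p` unless its end separates a swapped pair, that is,
unless `j ≡ p + 1`. -/
theorem simpleMap_lt_iff {p : ZMod (k + 1)} {l j : ℤ} (hj : (j : ZMod (k + 1)) ≠ p + 1) :
    simpleMap k p l < j ↔ l < j := by
  refine ⟨fun h => ?_, simpleMap_lt_of_lt hj⟩
  have := simpleMap_lt_of_lt hj h
  rwa [simpleMap_involutive k p l] at this

theorem ncard_mul_simpleTransposition (x : Equiv.Perm ℤ) {p : ZMod (k + 1)} {j : ℤ}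
    (hj : (j : ZMod (k + 1)) ≠ p + 1) (c : ℤ) :
    {l : ℤ | l < j ∧ c < (x * simpleTransposition k p) l}.ncard
      = {l : ℤ | l < j ∧ c < x l}.ncard := by
  rw [← Set.ncard_image_of_injective {l : ℤ | l < j ∧ c < x l}
    (simpleTransposition k p).injective]
  congr 1
  ext l
  simp only [Set.mem_image, Set.mem_ofPred_eq, Equiv.Perm.mul_apply, simpleTransposition_apply]
  constructor
  · rintro ⟨h1, h2⟩
    exact ⟨simpleMap k p l, ⟨(simpleMap_lt_iff hj).2 h1, h2⟩, simpleMap_involutive k p l⟩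
  · rintro ⟨m, ⟨h1, h2⟩, rfl⟩
    rw [simpleMap_involutive k p m]
    exact ⟨(simpleMap_lt_iff hj).2 h1, h2⟩

theorem periodic_mul_simpleTransposition {x : Equiv.Perm ℤ}
    (hx : ∀ i : ℤ, x (i + (k + 1)) = x i + (k + 1)) (p : ZMod (k + 1)) (i : ℤ) :
    (x * simpleTransposition k p) (i + (k + 1))
      = (x * simpleTransposition k p) i + (k + 1) := by
  simp only [Equiv.Perm.mul_apply, simpleTransposition_apply]
  rw [← hx]
  congr 1
  have : (((i + (k + 1) : ℤ)) : ZMod (k + 1)) = i := by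
    have := ZMod.natCast_self (k + 1)
    push_cast at this ⊢
    rw [this, add_zero]
  unfold simpleMap
  rw [this]
  split_ifs <;> ring

/-- The larger value `x (i + 1)` moves left past a smaller one, so its count is unchanged and now
sits in column `i - 1`. The smaller value `x i` moves right past a larger one and gains one
inversion in column `i`. -/
theorem inversionCode_mul_simpleTransposition {x : Equiv.Perm ℤ}
    (hx : ∀ i : ℤ, x (i + (k + 1)) = x i + (k + 1)) {i : ℤ} (hi : x i < x (i + 1)) :
    inversionCode k (x * simpleTransposition k (i : ZMod (k + 1)))
      = bumpHeights (i : ZMod (k + 1)) (inversionCode k x) := by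
  have hxs := periodic_mul_simpleTransposition hx (i : ZMod (k + 1))
  have hne := self_ne_add_one (i : ZMod (k + 1))
  have hpred : inversionCode k x ((i : ZMod (k + 1)) - 1) = leftInversions x i := by
    have := inversionCode_intCast hx (i - 1)
    push_cast at this
    rw [this, sub_add_cancel]
  funext r
  by_cases hr : r = (i : ZMod (k + 1))
  · rw [hr, bumpHeights_self, inversionCode_intCast hxs, hpred]
    unfold leftInversions
    rw [← ncard_mul_simpleTransposition x hne,
      ← Set.ncard_insert_of_notMem (a := i) (by simp)
        (finite_leftInversions hxs i (x i))]
    congr 1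
    ext l
    simp only [Set.mem_ofPred_eq, Set.mem_insert_iff, Equiv.Perm.mul_apply,
      simpleTransposition_apply, simpleMap_intCast_add_one]
    constructor
    · rintro ⟨h1, h2⟩
      rcases (Int.lt_add_one_iff.1 h1).eq_or_lt with h | h
      · exact Or.inl h
      · exact Or.inr ⟨h, h2⟩
    · rintro (rfl | ⟨h1, h2⟩)
      · exact ⟨by omega, by rwa [simpleMap_intCast]⟩
      · exact ⟨by omega, h2⟩
  · by_cases hr' : r = (i : ZMod (k + 1)) - 1
    · rw [hr', bumpHeights_pred]
      have h1 := inversionCode_intCast hxs (i - 1)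
      push_cast at h1
      rw [h1, inversionCode_intCast hx, sub_add_cancel]
      unfold leftInversions
      rw [ncard_mul_simpleTransposition x hne]
      simp only [Equiv.Perm.mul_apply, simpleTransposition_apply, simpleMap_intCast]
      congr 1
      ext l
      simp only [Set.mem_ofPred_eq]
      constructor
      · rintro ⟨h1, h2⟩
        exact ⟨by omega, h2⟩
      · rintro ⟨h1, h2⟩
        refine ⟨?_, h2⟩
        rcases (Int.lt_add_one_iff.1 h1).eq_or_lt with h | h
        · subst h
          exact absurd h2 (not_lt.2 hi.le)
        · exact h
    · rw [bumpHeights_of_ne _ hr hr']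
      have h1 := inversionCode_intCast hxs r.val
      have h2 := inversionCode_intCast hx r.val
      rw [intCast_val] at h1 h2
      rw [h1, h2]
      have h3 : (((r.val : ℤ) + 1 : ℤ) : ZMod (k + 1)) = r + 1 := by
        push_cast; simp
      have h4 : r + 1 ≠ (i : ZMod (k + 1)) + 1 := fun h => hr (add_right_cancel h)
      have h5 : r + 1 ≠ (i : ZMod (k + 1)) := fun h => hr' (eq_sub_of_add_eq h)
      unfold leftInversions
      rw [ncard_mul_simpleTransposition x (by rwa [h3])]
      have h6 : (x * simpleTransposition k (i : ZMod (k + 1))) (r.val + 1) = x (r.val + 1) := by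
        rw [Equiv.Perm.mul_apply, simpleTransposition_apply]
        unfold simpleMap
        rw [h3, if_neg h5, if_neg h4]
      rw [h6]

omit [NeZero k] in
theorem inversionCode_le_pred {x : Equiv.Perm ℤ}
    (hx : ∀ i : ℤ, x (i + (k + 1)) = x i + (k + 1)) {i : ℤ} (hi : x i < x (i + 1)) :
    inversionCode k x (i : ZMod (k + 1)) ≤ inversionCode k x ((i : ZMod (k + 1)) - 1) := by
  have h1 := inversionCode_intCast hx (i - 1)
  push_cast at h1
  rw [h1, inversionCode_intCast hx, sub_add_cancel]
  refine Set.ncard_le_ncard ?_ (finite_leftInversions hx _ _)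
  rintro l ⟨h2, h3⟩
  refine ⟨lt_of_le_of_ne (Int.lt_add_one_iff.1 h2) ?_, hi.trans h3⟩
  rintro rfl
  exact lt_asymm hi h3

/-- At a descent the heights come from an insertion. -/
theorem insertHeight_inversionCode_of_descent {x : Equiv.Perm ℤ}
    (hx : ∀ i : ℤ, x (i + (k + 1)) = x i + (k + 1)) {i : ℤ} (hi : x (i + 1) < x i) :
    insertHeight (inversionCode k (x * simpleTransposition k (i : ZMod (k + 1))))
      (i : ZMod (k + 1)) = some (inversionCode k x) := by
  have hxs := periodic_mul_simpleTransposition hx (i : ZMod (k + 1))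
  have hi' : (x * simpleTransposition k (i : ZMod (k + 1))) i
      < (x * simpleTransposition k (i : ZMod (k + 1))) (i + 1) := by
    simpa [simpleTransposition_apply, simpleMap_intCast, simpleMap_intCast_add_one] using hi
  rw [insertHeight_eq_some_iff]
  refine ⟨inversionCode_le_pred hxs hi', ?_⟩
  rw [← inversionCode_mul_simpleTransposition hxs hi', mul_assoc, simpleTransposition_mul_self,
    mul_one]

theorem pred_lt_inversionCode {x : Equiv.Perm ℤ}
    (hx : ∀ i : ℤ, x (i + (k + 1)) = x i + (k + 1)) {i : ℤ} (hi : x (i + 1) < x i) :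
    inversionCode k x ((i : ZMod (k + 1)) - 1) < inversionCode k x (i : ZMod (k + 1)) := by
  have h := insertHeight_eq_some_iff.1 (insertHeight_inversionCode_of_descent hx hi)
  rw [← h.2, bumpHeights_pred, bumpHeights_self]
  exact Nat.lt_succ_of_le h.1

/-- The success condition of insertion is the ascent condition, so ascents and descents can be read
off the code. -/
theorem inversionCode_le_pred_iff {x : Equiv.Perm ℤ}
    (hx : ∀ i : ℤ, x (i + (k + 1)) = x i + (k + 1)) (i : ℤ) :
    inversionCode k x (i : ZMod (k + 1)) ≤ inversionCode k x ((i : ZMod (k + 1)) - 1) ↔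
      x i < x (i + 1) := by
  refine ⟨fun h => ?_, inversionCode_le_pred hx⟩
  by_contra h'
  have hne : x (i + 1) ≠ x i := fun e => by have := x.injective e; omega
  exact absurd (pred_lt_inversionCode hx (lt_of_le_of_ne (not_lt.1 h') hne)) (not_lt.2 h)

omit [NeZero k] in
theorem inversionCode_one : inversionCode k 1 = 0 := by
  funext r
  simp only [inversionCode, leftInversions, Pi.zero_apply]
  rw [Set.ncard_eq_zero (finite_leftInversions (k := k) (x := 1) (fun _ => rfl) _ _)]
  ext l
  simp only [Equiv.Perm.one_apply, Set.mem_ofPred_eq, Set.mem_empty_iff_false, iff_false]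
  omega

/-! ### Affine permutations -/

omit [NeZero k] in
theorem sum_Icc_intCast (G : ZMod (k + 1) → ℤ) :
    ∑ i ∈ Finset.Icc (1 : ℤ) (k + 1), G (i : ZMod (k + 1)) = ∑ r, G r := by
  have hinj : Set.InjOn (fun i : ℤ => (i : ZMod (k + 1)))
      (Finset.Icc (1 : ℤ) (k + 1) : Finset ℤ) := by
    intro i hi j hj h
    obtain ⟨n, hn⟩ := eq_add_mul_of_intCast_eq h
    simp only [Finset.coe_Icc, Set.mem_Icc] at hi hj
    have h1 : n < 1 := by by_contra h'; nlinarith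
    have h2 : -1 < n := by by_contra h'; nlinarith
    have : n = 0 := by omega
    simpa [this] using hn
  rw [← Finset.sum_image (f := G) hinj]
  congr 1
  apply Finset.eq_univ_of_card
  rw [Finset.card_image_of_injOn hinj]
  simp

omit [NeZero k] in
theorem sum_Icc_id : ∑ i ∈ Finset.Icc (1 : ℤ) (k + 1), i = ((k + 2).choose 2 : ℤ) := by
  induction k with
  | zero => simp
  | succ k ih =>
    have : Finset.Icc (1 : ℤ) ((k + 1 : ℕ) + 1) = insert ((k : ℤ) + 2) (Finset.Icc (1 : ℤ) (k + 1)) := by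
      ext i
      simp only [Finset.mem_Icc, Finset.mem_insert]
      push_cast
      omega
    rw [this, Finset.sum_insert (by simp), ih, Nat.choose_succ_succ' (k + 2) 1]
    push_cast
    simp

-- Since displacements depend only on residues, the normalization of the window says that they sum
-- to zero over the residues.
omit [NeZero k] in
theorem isAffinePermutation_iff {x : Equiv.Perm ℤ} :
    IsAffinePermutation k x ↔ (∀ i : ℤ, x (i + (k + 1)) = x i + (k + 1)) ∧
      ∑ r : ZMod (k + 1), (x r.val - r.val) = 0 := by
  have key (hx : ∀ i : ℤ, x (i + (k + 1)) = x i + (k + 1)) :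
      ∑ r : ZMod (k + 1), (x r.val - r.val) =
        ∑ i ∈ Finset.Icc (1 : ℤ) (k + 1), x i - ((k + 2).choose 2 : ℤ) := by
    rw [← sum_Icc_id, ← Finset.sum_sub_distrib, ← sum_Icc_intCast]
    exact Finset.sum_congr rfl fun i _ => displacement_congr hx (intCast_val _)
  constructor
  · intro h
    exact ⟨h.periodic, by rw [key h.periodic, h.sum_window, sub_self]⟩
  · rintro ⟨h1, h2⟩
    exact ⟨by rw [key h1] at h2; linarith, h1⟩

omit [NeZero k] in
theorem isAffinePermutation_one : IsAffinePermutation k 1 :=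
  isAffinePermutation_iff.2 ⟨fun _ => rfl, by simp⟩

theorem IsAffinePermutation.mul_simpleTransposition {x : Equiv.Perm ℤ}
    (hx : IsAffinePermutation k x) (p : ZMod (k + 1)) :
    IsAffinePermutation k (x * simpleTransposition k p) := by
  rw [isAffinePermutation_iff] at hx ⊢
  refine ⟨periodic_mul_simpleTransposition hx.1 p, ?_⟩
  set G : ZMod (k + 1) → ℤ := fun r => x r.val - r.val with hG
  have hval : ∀ i : ℤ, x i = G (i : ZMod (k + 1)) + i := by
    intro i
    have := displacement_congr hx.1 (intCast_val (i : ZMod (k + 1)))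
    simp only [hG]
    linarith
  have hne := self_ne_add_one p
  -- The displacements at `p` and `p + 1` are exchanged, with corrections `+1` and `-1` that cancel
  -- in the sum.
  have h1 : ∀ r : ZMod (k + 1), (x * simpleTransposition k p) r.val - r.val
      = G (Equiv.swap p (p + 1) r)
        + ((if r = p then 1 else 0) - (if r = p + 1 then 1 else 0)) := by
    intro r
    rw [Equiv.Perm.mul_apply, simpleTransposition_apply, hval]
    unfold simpleMap
    rw [intCast_val]
    by_cases h : r = p
    · subst h
      simp [hne]
      ring
    · by_cases h' : r = p + 1
      · subst h'
        simp [hne.symm]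
        ring
      · simp [h, h', Equiv.swap_apply_of_ne_of_ne h h']
  simp_rw [h1]
  rw [Finset.sum_add_distrib, Equiv.sum_comp (Equiv.swap p (p + 1)) G, hx.2,
    Finset.sum_sub_distrib]
  simp

-- An increasing bijection of `ℤ` is a translation, and the normalization makes it trivial.
omit [NeZero k] in
theorem IsAffinePermutation.eq_one_of_ascents {x : Equiv.Perm ℤ}
    (hx : IsAffinePermutation k x) (h : ∀ i : ℤ, x i < x (i + 1)) : x = 1 := by
  have hmono : StrictMono x := strictMono_int_of_lt_succ h
  have hstep : ∀ i : ℤ, x (i + 1) = x i + 1 := by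
    intro i
    obtain ⟨j, hj⟩ := x.surjective (x i + 1)
    have h1 : i < j := hmono.lt_iff_lt.1 (by omega)
    have h2 := hmono.monotone (show i + 1 ≤ j by omega)
    have := h i
    omega
  have hlin : ∀ i : ℤ, x i = x 0 + i := by
    intro i
    induction i using Int.induction_on with
    | zero => simp
    | succ n ih => rw [hstep, ih]; ring
    | pred n ih =>
      have := hstep (-(n : ℤ) - 1)
      rw [sub_add_cancel, ih] at this
      linarith
  have hsum := (isAffinePermutation_iff.1 hx).2
  have h0 : x 0 = 0 := by
    have hterm : ∀ r : ZMod (k + 1), x r.val - r.val = x 0 := fun r => by rw [hlin]; ring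
    rw [Finset.sum_congr rfl fun r _ => hterm r, Finset.sum_const, Finset.card_univ, ZMod.card,
      nsmul_eq_mul, mul_eq_zero] at hsum
    rcases hsum with h | h
    · exfalso; omega
    · exact h
  ext i
  rw [hlin, h0]
  simp

omit [NeZero k] in
theorem IsAffinePermutation.exists_descent {x : Equiv.Perm ℤ}
    (hx : IsAffinePermutation k x) (h : x ≠ 1) : ∃ i : ℤ, x (i + 1) < x i := by
  by_contra! h'
  refine h (hx.eq_one_of_ascents fun i => lt_of_le_of_ne (h' i) fun e => ?_)
  have := x.injective e
  omega

/-! ### Words: reducedness and successful insertion -/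

theorem wordProduct_concat (w : List (ZMod (k + 1))) (p : ZMod (k + 1)) :
    wordProduct k (w ++ [p]) = wordProduct k w * simpleTransposition k p := by
  simp [wordProduct]

theorem isAffinePermutation_wordProduct (w : List (ZMod (k + 1))) :
    IsAffinePermutation k (wordProduct k w) := by
  induction w using List.reverseRecOn with
  | nil => exact isAffinePermutation_one
  | append_singleton w p ih =>
    rw [wordProduct_concat]
    exact ih.mul_simpleTransposition p

/-- Stripping off a descent lowers the total of the code by one, and a nontrivial affine permutation
always has a descent. -/
theorem exists_insertHeights_eq_inversionCode {x : Equiv.Perm ℤ}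
    (hx : IsAffinePermutation k x) :
    ∃ w, wordProduct k w = x ∧ insertHeights 0 w = some (inversionCode k x) := by
  induction hn : ∑ r, inversionCode k x r generalizing x with
  | zero =>
    have h : x = 1 := by
      by_contra h
      obtain ⟨i, hi⟩ := hx.exists_descent h
      have := pred_lt_inversionCode hx.periodic hi
      rw [Finset.sum_eq_zero_iff] at hn
      exact absurd (hn _ (Finset.mem_univ _)) (Nat.ne_of_gt (Nat.zero_lt_of_lt this))
    refine ⟨[], by simp [wordProduct, h], ?_⟩
    rw [h, inversionCode_one]
    rfl
  | succ n ih =>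
    have h : x ≠ 1 := by
      rintro rfl
      rw [inversionCode_one] at hn
      simp at hn
    obtain ⟨i, hi⟩ := hx.exists_descent h
    have hd := insertHeight_inversionCode_of_descent hx.periodic hi
    have hs := (insertHeight_eq_some_iff.1 hd).2
    obtain ⟨w, hw, hw'⟩ := ih (hx.mul_simpleTransposition (i : ZMod (k + 1))) (by
      rw [← hs, sum_bumpHeights] at hn
      omega)
    refine ⟨w ++ [(i : ZMod (k + 1))], ?_, ?_⟩
    · rw [wordProduct_concat, hw, mul_assoc, simpleTransposition_mul_self, mul_one]
    · rw [insertHeights_concat, hw', Option.bind_some, hd]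

theorem sum_eq_length_of_insertHeights {a b : ZMod (k + 1) → ℕ} {w : List (ZMod (k + 1))}
    (h : insertHeights a w = some b) : ∑ i, b i = ∑ i, a i + w.length := by
  induction w generalizing a with
  | nil => simp [insertHeights] at h; simp [h]
  | cons p w ih =>
    simp only [insertHeights, Option.bind_eq_some_iff] at h
    obtain ⟨c, hc, h⟩ := h
    rw [ih h, ← (insertHeight_eq_some_iff.1 hc).2, sum_bumpHeights, List.length_cons]
    ring

/-- A word whose insertion succeeds gives the inversion code of its product; a word whose
insertion fails is longer than the number of inversions of its product. -/
theorem insertHeights_dichotomy (w : List (ZMod (k + 1))) :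
    (insertHeights 0 w = some (inversionCode k (wordProduct k w)) ∨ insertHeights 0 w = none ∧
      ∑ r, inversionCode k (wordProduct k w) r < w.length) := by
  induction w using List.reverseRecOn with
  | nil => left; simp [insertHeights, wordProduct, inversionCode_one]
  | append_singleton w p ih =>
    have hx := isAffinePermutation_wordProduct (k := k) w
    rw [wordProduct_concat, insertHeights_concat, List.length_append, List.length_singleton]
    obtain ⟨i, rfl⟩ : ∃ i : ℤ, (i : ZMod (k + 1)) = p := ⟨_, intCast_val p⟩
    set x := wordProduct k w
    by_cases hi : x i < x (i + 1)
    · rw [inversionCode_mul_simpleTransposition hx.periodic hi]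
      rcases ih with h | ⟨h, h'⟩
      · left
        rw [h, Option.bind_some, insertHeight_eq_some_iff]
        exact ⟨inversionCode_le_pred hx.periodic hi, rfl⟩
      · right
        rw [h, sum_bumpHeights]
        exact ⟨rfl, by omega⟩
    -- At a descent the inversion count drops by one while the word grows, and insertion is refused
    -- because the height at `i` exceeds that at `i - 1`.
    · have hne : x (i + 1) ≠ x i := fun e => by have := x.injective e; omega
      have hi' : x (i + 1) < x i := lt_of_le_of_ne (not_lt.1 hi) hne
      have hs := (insertHeight_eq_some_iff.1
        (insertHeight_inversionCode_of_descent hx.periodic hi')).2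
      have hsum := sum_bumpHeights (i : ZMod (k + 1))
        (inversionCode k (x * simpleTransposition k (i : ZMod (k + 1))))
      rw [hs] at hsum
      right
      rcases ih with h | ⟨h, h'⟩
      · have hl := sum_eq_length_of_insertHeights h
        simp only [Pi.zero_apply, Finset.sum_const_zero] at hl
        refine ⟨?_, by omega⟩
        rw [h, Option.bind_some, insertHeight,
          if_neg (not_le.2 (pred_lt_inversionCode hx.periodic hi'))]
      · rw [h]
        exact ⟨rfl, by omega⟩

theorem inversionCode_wordProduct {w : List (ZMod (k + 1))} {a : ZMod (k + 1) → ℕ}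
    (h : insertHeights 0 w = some a) : inversionCode k (wordProduct k w) = a := by
  rcases insertHeights_dichotomy w with h' | ⟨h', -⟩
  · rw [h] at h'
    exact (Option.some.inj h').symm
  · rw [h] at h'
    exact absurd h' (by simp)

theorem sum_inversionCode_le_length (w : List (ZMod (k + 1))) :
    ∑ r, inversionCode k (wordProduct k w) r ≤ w.length := by
  rcases insertHeights_dichotomy w with h | ⟨-, h⟩
  · have := sum_eq_length_of_insertHeights h
    simp only [Pi.zero_apply, Finset.sum_const_zero] at this
    omega
  · exact h.le

/-- The inversion code determines an affine permutation. -/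
theorem IsAffinePermutation.eq_of_inversionCode_eq {x y : Equiv.Perm ℤ}
    (hx : IsAffinePermutation k x) (hy : IsAffinePermutation k y)
    (h : inversionCode k x = inversionCode k y) : x = y := by
  induction hn : ∑ r, inversionCode k x r generalizing x y with
  | zero =>
    have key : ∀ z : Equiv.Perm ℤ, IsAffinePermutation k z →
        ∑ r, inversionCode k z r = 0 → z = 1 := by
      intro z hz hn
      by_contra h
      obtain ⟨i, hi⟩ := hz.exists_descent h
      have := pred_lt_inversionCode hz.periodic hi
      rw [Finset.sum_eq_zero_iff] at hn
      exact absurd (hn _ (Finset.mem_univ _)) (Nat.ne_of_gt (Nat.zero_lt_of_lt this))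
    rw [key x hx hn, key y hy (h ▸ hn)]
  | succ n ih =>
    have hx1 : x ≠ 1 := by
      rintro rfl
      rw [inversionCode_one] at hn
      simp at hn
    obtain ⟨i, hi⟩ := hx.exists_descent hx1
    -- Equal codes have the same descents, so the same letter can be stripped from `x` and `y`.
    have hi' : y (i + 1) < y i := by
      have h1 := pred_lt_inversionCode hx.periodic hi
      rw [h, ← not_le, inversionCode_le_pred_iff hy.periodic] at h1
      exact lt_of_le_of_ne (not_lt.1 h1) fun e => by have := y.injective e; omega
    have hdx := insertHeight_eq_some_iff.1 (insertHeight_inversionCode_of_descent hx.periodic hi)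
    have hdy := insertHeight_eq_some_iff.1 (insertHeight_inversionCode_of_descent hy.periodic hi')
    have := ih (hx.mul_simpleTransposition (i : ZMod (k + 1)))
      (hy.mul_simpleTransposition (i : ZMod (k + 1)))
      (bumpHeights_injective _ (hdx.2.trans (h.trans hdy.2.symm))) (by
        rw [← hdx.2, sum_bumpHeights] at hn
        omega)
    exact mul_right_cancel this

/-- The reduced words are those whose insertion succeeds. -/
theorem isReducedWord_iff {x : Equiv.Perm ℤ} (hx : IsAffinePermutation k x)
    (w : List (ZMod (k + 1))) :
    IsReducedWord k x w ↔ insertHeights 0 w = some (inversionCode k x) := by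
  constructor
  · rintro ⟨rfl, hmin⟩
    rcases insertHeights_dichotomy w with h | ⟨-, h⟩
    · exact h
    · obtain ⟨v, hv, hv'⟩ := exists_insertHeights_eq_inversionCode hx
      have h1 := sum_eq_length_of_insertHeights hv'
      have h2 := hmin v hv
      simp only [Pi.zero_apply, Finset.sum_const_zero] at h1
      omega
  · intro h
    have hw := (isAffinePermutation_wordProduct w).eq_of_inversionCode_eq hx
      (inversionCode_wordProduct h)
    refine ⟨hw, fun v hv => ?_⟩
    have h1 := sum_eq_length_of_insertHeights h
    have h2 := sum_inversionCode_le_length v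
    simp only [Pi.zero_apply, Finset.sum_const_zero] at h1
    rw [hv] at h2
    omega

end

/-! ### Fillings -/

section
variable {k : ℕ}

/-- The rows of the filling with the given column heights, from the bottom up. -/
def fillingOfHeights (a : ZMod (k + 1) → ℕ) : List (Finset (ZMod (k + 1))) :=
  (List.range (Finset.univ.sup a)).map fun j =>
    (Finset.univ.filter fun i => j < a i).image fun i => i - (j : ZMod (k + 1))

theorem sup_tailHeights (a : ZMod (k + 1) → ℕ) :
    Finset.univ.sup (tailHeights a) = Finset.univ.sup a - 1 := by
  apply le_antisymm
  · refine Finset.sup_le fun i _ => ?_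
    exact Nat.sub_le_sub_right (Finset.le_sup (f := a) (Finset.mem_univ (i + 1))) 1
  · rw [Nat.sub_le_iff_le_add]
    refine Finset.sup_le fun i _ => ?_
    have := Finset.le_sup (f := tailHeights a) (Finset.mem_univ (i - 1))
    simp only [tailHeights, sub_add_cancel] at this
    omega

theorem fillingOfHeights_zero : fillingOfHeights (0 : ZMod (k + 1) → ℕ) = [] := by
  have : Finset.univ.sup (0 : ZMod (k + 1) → ℕ) = 0 := by
    rw [← Nat.le_zero]
    exact Finset.sup_le fun i _ => le_rfl
  simp [fillingOfHeights, this]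

/-- The box of column `s` in row `j + 1` has residue `s - (j + 1) = (s - 1) - j`, which accounts for
the column shift in `tailHeights`. -/
theorem fillingOfHeights_of_ne_zero {a : ZMod (k + 1) → ℕ} (ha : a ≠ 0) :
    fillingOfHeights a = heightSupport a :: fillingOfHeights (tailHeights a) := by
  obtain ⟨i, hi⟩ : ∃ i, a i ≠ 0 := Function.ne_iff.1 ha
  have hle := Finset.le_sup (f := a) (Finset.mem_univ i)
  obtain ⟨n, hn⟩ : ∃ n, Finset.univ.sup a = n + 1 := Nat.exists_eq_succ_of_ne_zero (by omega)
  rw [fillingOfHeights, fillingOfHeights, sup_tailHeights, hn, List.range_succ_eq_map,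
    List.map_cons, List.map_map, Nat.add_sub_cancel]
  congr 1
  · simp [heightSupport]
  · refine List.map_congr_left fun j _ => ?_
    ext r
    simp only [Function.comp, Finset.mem_image, Finset.mem_filter, Finset.mem_univ, true_and]
    have htail : ∀ s, j < tailHeights a s ↔ j + 1 < a (s + 1) := fun s => by
      simp only [tailHeights]; omega
    simp only [htail]
    constructor
    · rintro ⟨s, hs, rfl⟩
      exact ⟨s - 1, by rwa [sub_add_cancel], by push_cast; ring⟩
    · rintro ⟨s, hs, rfl⟩
      exact ⟨s + 1, hs, by push_cast; ring⟩

theorem sum_tailHeights_lt {a : ZMod (k + 1) → ℕ} (ha : a ≠ 0) :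
    ∑ i, tailHeights a i < ∑ i, a i := by
  obtain ⟨i, hi⟩ : ∃ i, a i ≠ 0 := Function.ne_iff.1 ha
  rw [← Equiv.sum_comp (Equiv.addRight (1 : ZMod (k + 1))) a]
  refine Finset.sum_lt_sum (fun j _ => Nat.sub_le _ _) ⟨i - 1, Finset.mem_univ _, ?_⟩
  simp only [tailHeights, Equiv.coe_addRight, sub_add_cancel]
  exact Nat.sub_lt (Nat.pos_of_ne_zero hi) one_pos

theorem heights_induction {motive : (ZMod (k + 1) → ℕ) → Prop} (zero : motive 0)
    (tail : ∀ a, a ≠ 0 → motive (tailHeights a) → motive a) (a : ZMod (k + 1) → ℕ) :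
    motive a := by
  induction hn : ∑ i, a i using Nat.strong_induction_on generalizing a with
  | _ n ih =>
    by_cases ha : a = 0
    · rwa [ha]
    · exact tail a ha (ih _ (hn ▸ sum_tailHeights_lt ha) _ rfl)

theorem tailHeights_exists_zero {a : ZMod (k + 1) → ℕ} (ha : ∃ i, a i = 0) :
    ∃ i, tailHeights a i = 0 := by
  obtain ⟨i, hi⟩ := ha
  exact ⟨i - 1, by simp [tailHeights, hi]⟩

theorem heightSupport_ne_univ {a : ZMod (k + 1) → ℕ} (ha : ∃ i, a i = 0) :
    heightSupport a ≠ Finset.univ := by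
  obtain ⟨i, hi⟩ := ha
  intro h
  have := Finset.mem_univ i
  rw [← h, mem_heightSupport] at this
  omega

theorem ne_univ_of_mem_fillingOfHeights {a : ZMod (k + 1) → ℕ} (ha : ∃ i, a i = 0) :
    ∀ S ∈ fillingOfHeights a, S ≠ Finset.univ := by
  induction a using heights_induction with
  | zero => simp [fillingOfHeights_zero]
  | tail a h ih =>
    rw [fillingOfHeights_of_ne_zero h]
    simp only [List.mem_cons, forall_eq_or_imp]
    exact ⟨heightSupport_ne_univ ha, ih (tailHeights_exists_zero ha)⟩

/-! ### Reading words of fillings and maximality of the shape -/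

theorem exists_forall₂_isDecreasingWord (B : List (Finset (ZMod (k + 1))))
    (hB : ∀ S ∈ B, S ≠ Finset.univ) : ∃ u, List.Forall₂ IsDecreasingWord B u := by
  induction B with
  | nil => exact ⟨[], .nil⟩
  | cons A B ih =>
    obtain ⟨v, hv⟩ := exists_isDecreasingWord A (hB A (by simp))
    obtain ⟨u, hu⟩ := ih fun S hS => hB S (by simp [hS])
    exact ⟨v :: u, .cons hv hu⟩

variable [NeZero k]

/-- Inserting a reading word of a filling returns the filling. -/
theorem insertHeights_reverse_flatten {a : ZMod (k + 1) → ℕ}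
    {u : List (List (ZMod (k + 1)))}
    (hu : List.Forall₂ IsDecreasingWord (fillingOfHeights a) u) :
    insertHeights 0 u.reverse.flatten = some a := by
  induction a using heights_induction generalizing u with
  | zero =>
    rw [fillingOfHeights_zero] at hu
    cases hu
    rfl
  | tail a h ih =>
    rw [fillingOfHeights_of_ne_zero h] at hu
    cases hu with
    | cons hv hu =>
      rw [List.reverse_cons, List.flatten_append, List.flatten_singleton, insertHeights_append,
        ih hu, Option.bind_some, insertHeights_tailHeights hv]

/-- Inserting a reading word recovers the heights. The zero of `a` makes all rows proper, so that a
reading word exists. -/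
theorem fillingOfHeights_injective {a b : ZMod (k + 1) → ℕ} (ha : ∃ i, a i = 0)
    (h : fillingOfHeights a = fillingOfHeights b) : a = b := by
  obtain ⟨u, hu⟩ := exists_forall₂_isDecreasingWord _ (ne_univ_of_mem_fillingOfHeights ha)
  have h1 := insertHeights_reverse_flatten hu
  rw [h] at hu
  rw [insertHeights_reverse_flatten hu] at h1
  exact (Option.some.inj h1).symm

omit [NeZero k] in
theorem shape_fillingOfHeights_zero (a : ZMod (k + 1) → ℕ) :
    shape (fillingOfHeights a) 0 = (heightSupport a).card := by
  by_cases ha : a = 0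
  · subst ha
    simp [fillingOfHeights_zero, shape, heightSupport]
  · rw [fillingOfHeights_of_ne_zero ha]
    rfl

omit [NeZero k] in
theorem shape_fillingOfHeights_succ (a : ZMod (k + 1) → ℕ) (n : ℕ) :
    shape (fillingOfHeights a) (n + 1) = shape (fillingOfHeights (tailHeights a)) n := by
  by_cases ha : a = 0
  · subst ha
    have : tailHeights (0 : ZMod (k + 1) → ℕ) = 0 := rfl
    simp [this, fillingOfHeights_zero, shape]
  · rw [fillingOfHeights_of_ne_zero ha]
    rfl

/-- Among the decompositions whose reading word inserts to the heights `a`, the filling of `a` has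
the lexicographically largest shape. -/
theorem shape_le_shape_fillingOfHeights {B : List (Finset (ZMod (k + 1)))}
    {u : List (List (ZMod (k + 1)))} (hu : List.Forall₂ IsDecreasingWord B u)
    {a : ZMod (k + 1) → ℕ} (h : insertHeights 0 u.reverse.flatten = some a) :
    toLex (shape B) ≤ toLex (shape (fillingOfHeights a)) := by
  have key : shape B = shape (fillingOfHeights a) ∨ ∃ n,
      (∀ m < n, shape B m = shape (fillingOfHeights a) m) ∧
        shape B n < shape (fillingOfHeights a) n := by
    induction hu generalizing a with
    | nil =>
      simp [insertHeights] at h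
      left
      rw [← h]
      simp [fillingOfHeights_zero]
    | @cons A v B u hv hu ih =>
      rw [List.reverse_cons, List.flatten_append, List.flatten_singleton, insertHeights_append,
        Option.bind_eq_some_iff] at h
      obtain ⟨b, hb, hba⟩ := h
      have hsub := subset_heightSupport_of_insertHeights hv hba
      have h0 : shape (A :: B) 0 = A.card := rfl
      -- A strictly smaller bottom row decides the lexicographic comparison at once. If the sizes
      -- agree, so do the rows, and cancelling them leaves the rest inserting to `tailHeights a`.
      rcases (Finset.card_le_card hsub).eq_or_lt with hc | hc
      · have hA := Finset.eq_of_subset_of_card_le hsub hc.ge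
        have htail : b = tailHeights a :=
          insertHeights_injective hba (insertHeights_tailHeights (hA ▸ hv))
        subst htail
        rcases ih hb with heq | ⟨n, hn, hn'⟩
        · left
          funext m
          cases m with
          | zero => rw [h0, shape_fillingOfHeights_zero, hc]
          | succ m => rw [shape_fillingOfHeights_succ, ← heq]; rfl
        · right
          refine ⟨n + 1, fun m hm => ?_, ?_⟩
          · cases m with
            | zero => rw [h0, shape_fillingOfHeights_zero, hc]
            | succ m => rw [shape_fillingOfHeights_succ, ← hn m (by omega)]; rfl
          · rw [shape_fillingOfHeights_succ]
            exact hn'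
      · right
        exact ⟨0, by simp, by rwa [h0, shape_fillingOfHeights_zero]⟩
  rcases key with h | ⟨n, h1, h2⟩
  · rw [h]
  · exact le_of_lt ⟨n, h1, h2⟩

/-! ### Insertion into fillings -/

/-- A labelled filling: the residues and the labels of each row. -/
abbrev LabelledFilling (k : ℕ) := List (Finset (ZMod (k + 1)) × RecordingRow k)

/-- This is why bump and braid both continue with `p - 1` in the next row. -/
theorem tailHeights_bumpHeights {a : ZMod (k + 1) → ℕ} {p : ZMod (k + 1)} (h : 0 < a (p - 1)) :
    tailHeights (bumpHeights p a) = bumpHeights (p - 1) (tailHeights a) := by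
  funext i
  by_cases h1 : i = p - 1
  · subst h1
    rw [bumpHeights_self]
    simp only [tailHeights, sub_add_cancel, bumpHeights_self]
    omega
  · by_cases h2 : i = p - 1 - 1
    · subst h2
      rw [bumpHeights_pred]
      simp [tailHeights, bumpHeights_pred]
    · rw [bumpHeights_of_ne _ h1 h2]
      simp only [tailHeights]
      rw [bumpHeights_of_ne]
      · exact fun h => h1 (eq_sub_of_add_eq h)
      · exact fun h => h2 (eq_sub_of_add_eq h)

theorem bumpHeights_ne_zero (p : ZMod (k + 1)) (a : ZMod (k + 1) → ℕ) :
    bumpHeights p a ≠ 0 := by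
  intro h
  have := congrFun h p
  rw [bumpHeights_self] at this
  simp at this

/-- Insertion into a filling is insertion on its column heights. -/
theorem map_insertResidue (m : ℕ) {T : LabelledFilling k} {a : ZMod (k + 1) → ℕ}
    (hT : T.map Prod.fst = fillingOfHeights a) (p : ZMod (k + 1)) :
    (insertResidue m T p).map (List.map Prod.fst) =
      (insertHeight a p).map fillingOfHeights := by
  have hne := sub_one_ne_self p
  induction a using heights_induction generalizing T p with
  | zero =>
    rw [fillingOfHeights_zero, List.map_eq_nil_iff] at hT
    subst hT
    have hs : heightSupport (bumpHeights p (0 : ZMod (k + 1) → ℕ)) = {p} := by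
      ext i
      rw [mem_heightSupport, Finset.mem_singleton]
      by_cases h1 : i = p
      · simp [h1, bumpHeights_self]
      · by_cases h2 : i = p - 1
        · simp [h2, bumpHeights_pred, hne]
        · simp [bumpHeights_of_ne _ h1 h2, h1]
    have ht : tailHeights (bumpHeights p (0 : ZMod (k + 1) → ℕ)) = 0 := by
      funext i
      simp only [tailHeights, Pi.zero_apply]
      by_cases h1 : i + 1 = p
      · simp [h1, bumpHeights_self]
      · by_cases h2 : i + 1 = p - 1
        · simp [h2, bumpHeights_pred]
        · simp [bumpHeights_of_ne _ h1 h2]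
    simp [insertResidue, insertHeight, fillingOfHeights_of_ne_zero (bumpHeights_ne_zero p _), hs,
      ht, fillingOfHeights_zero]
  | tail a ha ih =>
    rw [fillingOfHeights_of_ne_zero ha] at hT
    obtain ⟨⟨_, Q⟩, T, rfl, rfl, hrows⟩ := List.map_eq_cons_iff.1 hT
    have hrec := ih hrows (p - 1) (sub_one_ne_self _)
    have htail : tailHeights a (p - 1) = a p - 1 := by simp [tailHeights]
    have htail' : tailHeights a (p - 1 - 1) = a (p - 1) - 1 := by simp [tailHeights]
    have hb := bumpHeights_ne_zero p a
    have hin : p ∈ heightSupport a ↔ 0 < a p := mem_heightSupport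
    have hin' : p - 1 ∈ heightSupport a ↔ 0 < a (p - 1) := mem_heightSupport
    have hmem : ∀ i, i ∈ heightSupport (bumpHeights p a) ↔
        i = p ∨ (i = p - 1 ∧ 0 < a p) ∨ (i ≠ p ∧ i ≠ p - 1 ∧ 0 < a i) := by
      intro i
      rw [mem_heightSupport]
      by_cases h1 : i = p
      · simp [h1, bumpHeights_self]
      · by_cases h2 : i = p - 1
        · simp [h2, bumpHeights_pred, hne]
        · simp [bumpHeights_of_ne _ h1 h2, h1, h2]
    rw [insertResidue]
    -- The signs of `a p` and `a (p - 1)` separate the four cases: both positive is a braid, only `a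
    -- p` a failure, only `a (p - 1)` a bump, neither an inclusion.
    by_cases hp : 0 < a p
    · rw [if_neg (by simp [hin, hp])]
      by_cases hp' : 0 < a (p - 1)
      · rw [if_pos (hin'.2 hp'), Option.map_map]
        have hs : heightSupport (bumpHeights p a) = heightSupport a := by
          ext i
          rw [hmem, mem_heightSupport]
          by_cases h1 : i = p
          · simp [h1, hp]
          · by_cases h2 : i = p - 1
            · simp [h2, hp, hp', hne]
            · simp [h1, h2]
        have hcomp : (List.map Prod.fst ∘ fun rows' => (heightSupport a, Q) :: rows') =
            (fun R => heightSupport a :: R) ∘ List.map Prod.fst := rfl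
        rw [hcomp, ← Option.map_map, hrec]
        unfold insertHeight
        rw [htail, htail']
        by_cases hle : a p ≤ a (p - 1)
        · rw [if_pos hle, if_pos (by omega)]
          simp [fillingOfHeights_of_ne_zero hb, hs, tailHeights_bumpHeights hp']
        · rw [if_neg hle, if_neg (by omega)]
          rfl
      · rw [if_neg (by simpa [hin'] using hp'), insertHeight, if_neg (by omega)]
        rfl
    · rw [if_pos (by simpa [hin] using hp)]
      have hle : a p ≤ a (p - 1) := by omega
      rw [insertHeight_eq_some_iff.2 ⟨hle, rfl⟩, Option.map_some, fillingOfHeights_of_ne_zero hb]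
      by_cases hp' : 0 < a (p - 1)
      · rw [if_neg (by simp [hin', hp']), Option.map_map]
        have hs : heightSupport (bumpHeights p a) = insert p ((heightSupport a).erase (p - 1)) := by
          ext i
          rw [hmem, Finset.mem_insert, Finset.mem_erase, mem_heightSupport]
          by_cases h1 : i = p
          · simp [h1]
          · simp [h1, hp]
        rw [hs, tailHeights_bumpHeights hp']
        rw [insertHeight, if_pos (by omega), Option.map_some, Option.map_eq_some_iff] at hrec
        obtain ⟨R, hR, hR'⟩ := hrec
        simp [hR, hR']
      · rw [if_pos (by simpa [hin'] using hp')]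
        have hs : heightSupport (bumpHeights p a) = insert p (heightSupport a) := by
          ext i
          rw [hmem, Finset.mem_insert, mem_heightSupport]
          by_cases h1 : i = p
          · simp [h1]
          · by_cases h2 : i = p - 1
            · simp [h2, hp, hp']
            · simp [h1, h2]
        have ht : tailHeights (bumpHeights p a) = tailHeights a := by
          funext i
          simp only [tailHeights]
          by_cases h1 : i + 1 = p
          · rw [h1, bumpHeights_self]; omega
          · by_cases h2 : i + 1 = p - 1
            · rw [h2, bumpHeights_pred]; omega
            · rw [bumpHeights_of_ne _ h1 h2]
        simp [hs, ht, hrows]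

theorem map_insertLetters (m : ℕ) {T : LabelledFilling k} {a : ZMod (k + 1) → ℕ}
    (hT : T.map Prod.fst = fillingOfHeights a) (w : List (ZMod (k + 1))) :
    (insertLetters m T w).map (List.map Prod.fst) =
      (insertHeights a w).map fillingOfHeights := by
  induction w generalizing m T a with
  | nil => simp [insertLetters, insertHeights, hT]
  | cons p w ih =>
    have h := map_insertResidue (m + 1) hT p
    rw [insertLetters, insertHeights]
    cases hc : insertHeight a p with
    | none =>
      rw [hc, Option.map_none, Option.map_eq_none_iff] at h
      rw [h]
      rfl
    | some b =>
      rw [hc, Option.map_some, Option.map_eq_some_iff] at h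
      obtain ⟨R, hR, hR'⟩ := h
      rw [hR, Option.bind_some, Option.bind_some]
      exact ih (m + 1) hR'

theorem map_fst_insertWord (w : List (ZMod (k + 1))) :
    (insertWord w).map Prod.fst = (insertHeights 0 w).map fillingOfHeights := by
  rw [← map_insertLetters 0 (T := []) (by simp [fillingOfHeights_zero]) w, insertWord,
    Option.map_map]
  congr 1
  funext T
  simp [List.unzip_fst]

end

/-! ### Recovering a word from its recording tableau -/

section
variable {k : ℕ}

/-- The rows are nonempty, exactly their boxes are labelled, and all labels are at most `m`. -/
def IsLabelledUpTo (m : ℕ) (T : LabelledFilling k) : Prop :=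
  ∀ R ∈ T, R.1.Nonempty ∧ (∀ i, R.2 i = none ↔ i ∉ R.1) ∧ ∀ i n, R.2 i = some n → n ≤ m

theorem IsLabelledUpTo.mono {m n : ℕ} (h : m ≤ n) {T : LabelledFilling k}
    (hT : IsLabelledUpTo m T) : IsLabelledUpTo n T :=
  fun R hR => ⟨(hT R hR).1, (hT R hR).2.1, fun i l hl => ((hT R hR).2.2 i l hl).trans h⟩

theorem isLabelledUpTo_cons {m : ℕ} {R : Finset (ZMod (k + 1)) × RecordingRow k}
    {T : LabelledFilling k} : IsLabelledUpTo m (R :: T) ↔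
      (R.1.Nonempty ∧ (∀ i, R.2 i = none ↔ i ∉ R.1) ∧ ∀ i n, R.2 i = some n → n ≤ m) ∧
        IsLabelledUpTo m T := by
  simp [IsLabelledUpTo]

variable [NeZero k]

theorem IsLabelledUpTo.insertResidue {m : ℕ} {T R : LabelledFilling k} {p : ZMod (k + 1)}
    (hT : IsLabelledUpTo m T) (h : insertResidue (m + 1) T p = some R) :
    IsLabelledUpTo (m + 1) R := by
  induction T generalizing R p with
  | nil =>
    simp only [_root_.insertResidue, Option.some.injEq] at h
    subst h
    rw [isLabelledUpTo_cons]
    refine ⟨⟨by simp, fun i => ?_, fun i n => ?_⟩, by simp [IsLabelledUpTo]⟩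
    · by_cases hi : i = p <;> simp [hi]
    · by_cases hi : i = p
      · simp [hi]; omega
      · simp [hi]
  | cons AQ T ih =>
    obtain ⟨A, Q⟩ := AQ
    have hne := sub_one_ne_self p
    obtain ⟨⟨h1, h2, h3⟩, hT⟩ := isLabelledUpTo_cons.1 hT
    simp only at h1 h2 h3
    rw [_root_.insertResidue] at h
    split_ifs at h with hp hp' hp'
    · rw [Option.map_eq_some_iff] at h
      obtain ⟨R, hR, rfl⟩ := h
      rw [isLabelledUpTo_cons]
      exact ⟨⟨h1, h2, fun i n h => (h3 i n h).trans (Nat.le_succ m)⟩, ih hT hR⟩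
    · rw [Option.map_eq_some_iff] at h
      obtain ⟨R, hR, rfl⟩ := h
      rw [isLabelledUpTo_cons]
      refine ⟨⟨by simp, fun i => ?_, fun i n => ?_⟩, ih hT hR⟩
      · by_cases hi : i = p - 1
        · simp [hi, hne]
        · by_cases hi' : i = p
          · have := (h2 (p - 1)).not
            simp [hi', Function.update_of_ne hne.symm, this, hp']
          · simp [hi, hi', h2]
      · by_cases hi : i = p - 1
        · simp [hi]
        · by_cases hi' : i = p
          · simpa [hi', Function.update_of_ne hne.symm] using
              fun h => (h3 (p - 1) n h).trans (Nat.le_succ m)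
          · simpa [hi, hi'] using fun h => (h3 i n h).trans (Nat.le_succ m)
    · rw [Option.some.injEq] at h
      subst h
      rw [isLabelledUpTo_cons]
      refine ⟨⟨by simp, fun i => ?_, fun i n => ?_⟩, hT.mono (Nat.le_succ m)⟩
      · by_cases hi : i = p
        · simp [hi]
        · simp [hi, h2]
      · by_cases hi : i = p
        · simp [hi]; omega
        · simpa [hi] using fun h => (h3 i n h).trans (Nat.le_succ m)

/-- The new label is in the first row exactly after an inclusion in the first row. -/
theorem exists_label_head_iff {m : ℕ} {A B : Finset (ZMod (k + 1))}
    {Q S : RecordingRow k} {T R : LabelledFilling k} {p : ZMod (k + 1)}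
    (hT : IsLabelledUpTo m ((A, Q) :: T))
    (h : _root_.insertResidue (m + 1) ((A, Q) :: T) p = some ((B, S) :: R)) :
    (∃ i, S i = some (m + 1)) ↔ p ∉ A ∧ p - 1 ∉ A := by
  obtain ⟨⟨h1, h2, h3⟩, hT⟩ := isLabelledUpTo_cons.1 hT
  simp only at h1 h2 h3
  have hne := sub_one_ne_self p
  have hQ : ∀ i, Q i ≠ some (m + 1) := fun i hi => by have := h3 i _ hi; omega
  rw [_root_.insertResidue] at h
  split_ifs at h with hp hp' hp'
  · simp only [Option.map_eq_some_iff, List.cons.injEq, Prod.mk.injEq] at h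
    obtain ⟨_, -, ⟨-, rfl⟩, -⟩ := h
    exact ⟨fun ⟨i, hi⟩ => absurd hi (hQ i), fun h => absurd hp' h.2⟩
  · simp only [Option.map_eq_some_iff, List.cons.injEq, Prod.mk.injEq] at h
    obtain ⟨_, -, ⟨-, rfl⟩, -⟩ := h
    refine ⟨?_, fun h => absurd hp' h.2⟩
    rintro ⟨i, hi⟩
    exfalso
    by_cases h1 : i = p - 1
    · simp [h1] at hi
    · by_cases h2 : i = p
      · rw [h2, Function.update_of_ne hne.symm, Function.update_self] at hi
        exact hQ _ hi
      · rw [Function.update_of_ne h1, Function.update_of_ne h2] at hi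
        exact hQ _ hi
  · simp only [Option.some.injEq, List.cons.injEq, Prod.mk.injEq] at h
    obtain ⟨⟨-, rfl⟩, -⟩ := h
    exact ⟨fun _ => ⟨hp, hp'⟩, fun _ => ⟨p, by simp⟩⟩

end

section
variable {k : ℕ} [NeZero k]

/-- Insertion of a new label can be undone. -/
theorem insertResidue_injective {m : ℕ} {T T' R : LabelledFilling k} {p p' : ZMod (k + 1)}
    (hT : IsLabelledUpTo m T) (hT' : IsLabelledUpTo m T')
    (h : insertResidue (m + 1) T p = some R) (h' : insertResidue (m + 1) T' p' = some R) :
    T = T' ∧ p = p' := by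
  induction T generalizing T' R p p' with
  | nil =>
    cases T' with
    | nil =>
      rw [← h'] at h
      simp only [insertResidue, Option.some.injEq, List.cons.injEq, Prod.mk.injEq,
        Finset.singleton_inj] at h
      exact ⟨rfl, h.1.1⟩
    | cons AQ T' => exact (cons_ne_nil hT' h' h).elim
  | cons AQ T ih =>
    cases T' with
    | nil => exact (cons_ne_nil hT h h').elim
    | cons AQ' T' =>
      obtain ⟨A, Q⟩ := AQ
      obtain ⟨A', Q'⟩ := AQ'
      cases R with
      | nil => exact (insertResidue_ne_nil h).elim
      | cons BS R =>
        obtain ⟨B, S⟩ := BS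
        have hi := exists_label_head_iff hT h
        have hi' := exists_label_head_iff hT' h'
        obtain ⟨⟨h1, h2, h3⟩, hT⟩ := isLabelledUpTo_cons.1 hT
        obtain ⟨⟨h1', h2', h3'⟩, hT'⟩ := isLabelledUpTo_cons.1 hT'
        simp only at h1 h2 h3 h1' h2' h3'
        rw [hi] at hi'
        have hne := sub_one_ne_self p
        rw [insertResidue] at h h'
        by_cases hinc : p ∉ A ∧ p - 1 ∉ A
        · have hinc' := hi'.1 hinc
          rw [if_pos hinc.1, if_pos hinc.2] at h
          rw [if_pos hinc'.1, if_pos hinc'.2] at h'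
          simp only [Option.some.injEq, List.cons.injEq, Prod.mk.injEq] at h h'
          obtain ⟨⟨hB, hS⟩, rfl⟩ := h
          obtain ⟨⟨hB', hS'⟩, rfl⟩ := h'
          -- The label `m + 1` marks the included box. If `p ≠ p'`, the box at `p` would carry it
          -- already in `Q'`, whose labels are at most `m`.
          have hp : p = p' := by
            by_contra hpp
            have : S p = some (m + 1) := by rw [← hS]; simp
            rw [← hS', Function.update_of_ne hpp] at this
            have := h3' _ _ this
            omega
          subst hp
          refine ⟨?_, rfl⟩
          have hA : A = A' := by
            rw [← Finset.erase_insert hinc.1, hB, ← hB', Finset.erase_insert hinc'.1]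
          have hQ : Q = Q' := by
            funext i
            by_cases hip : i = p
            · rw [hip, (h2 p).2 hinc.1, (h2' p).2 hinc'.1]
            · have := congrFun (hS.trans hS'.symm) i
              simpa [hip] using this
          rw [hA, hQ]
        · have hinc' := fun c => hinc (hi'.2 c)
          have hrow : ∃ R₀, insertResidue (m + 1) T (p - 1) = some R₀ ∧
              (if p ∈ A then (A, Q) else (insert p (A.erase (p - 1)),
                Function.update (Function.update Q p (Q (p - 1))) (p - 1) none)) = (B, S) ∧
              R₀ = R ∧ p - 1 ∈ A := by
            split_ifs at h with hp hp' hp'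
            · simp only [Option.map_eq_some_iff, List.cons.injEq] at h
              obtain ⟨R₀, ha, hb, hc⟩ := h
              exact ⟨R₀, ha, by rw [if_pos hp]; exact hb, hc, hp'⟩
            · simp only [Option.map_eq_some_iff, List.cons.injEq] at h
              obtain ⟨R₀, ha, hb, hc⟩ := h
              exact ⟨R₀, ha, by rw [if_neg hp]; exact hb, hc, hp'⟩
            · exact absurd ⟨hp, hp'⟩ hinc
          have hrow' : ∃ R₀, insertResidue (m + 1) T' (p' - 1) = some R₀ ∧
              (if p' ∈ A' then (A', Q') else (insert p' (A'.erase (p' - 1)),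
                Function.update (Function.update Q' p' (Q' (p' - 1))) (p' - 1) none)) = (B, S) ∧
              R₀ = R ∧ p' - 1 ∈ A' := by
            split_ifs at h' with hp hp' hp'
            · simp only [Option.map_eq_some_iff, List.cons.injEq] at h'
              obtain ⟨R₀, ha, hb, hc⟩ := h'
              exact ⟨R₀, ha, by rw [if_pos hp]; exact hb, hc, hp'⟩
            · simp only [Option.map_eq_some_iff, List.cons.injEq] at h'
              obtain ⟨R₀, ha, hb, hc⟩ := h'
              exact ⟨R₀, ha, by rw [if_neg hp]; exact hb, hc, hp'⟩
            · exact absurd ⟨hp, hp'⟩ hinc'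
          obtain ⟨R₀, hR, hh, rfl, hpA⟩ := hrow
          obtain ⟨R₁, hR', hh', rfl, hpA'⟩ := hrow'
          obtain ⟨rfl, hpp⟩ := ih hT hT' hR hR'
          have hpp : p = p' := sub_left_injective hpp
          subst hpp
          refine ⟨?_, rfl⟩
          have hhh := hh.trans hh'.symm
          -- A braid keeps `p - 1` in the row and a bump removes it, so the mixed cases are
          -- contradictory.
          split_ifs at hhh with hp hp' hp'
          · rw [hhh]
          · have := congrArg (fun x => p - 1 ∈ x.1) hhh
            simp [hpA, hne] at this
          · have := congrArg (fun x => p - 1 ∈ x.1) hhh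
            simp [hpA', hne] at this
          · rw [Prod.mk.injEq] at hhh
            obtain ⟨hB, hS⟩ := hhh
            have hA : A = A' := by
              have := congrArg (fun x => insert (p - 1) (x.erase p)) hB
              simpa [hp, hp', Finset.erase_insert, Finset.insert_erase hpA,
                Finset.insert_erase hpA'] using this
            have hQ : Q = Q' := by
              funext i
              by_cases h4 : i = p
              · rw [h4, (h2 p).2 hp, (h2' p).2 hp']
              · by_cases h5 : i = p - 1
                · have := congrFun hS p
                  simpa [Function.update_of_ne hne.symm, h5] using this
                · have := congrFun hS i
                  simpa [h4, h5] using this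
            rw [hA, hQ]
where
  insertResidue_ne_nil {m : ℕ} {T : LabelledFilling k} {p : ZMod (k + 1)}
      (h : insertResidue m T p = some []) : False := by
    cases T with
    | nil => simp [insertResidue] at h
    | cons AQ T =>
      obtain ⟨A, Q⟩ := AQ
      rw [insertResidue] at h
      split_ifs at h <;> simp at h
  -- Insertion into the empty filling leaves one box, carrying the new label. From a nonempty row
  -- this would need an inclusion, leaving at least two boxes.
  cons_ne_nil {m : ℕ} {AQ : Finset (ZMod (k + 1)) × RecordingRow k} {T R : LabelledFilling k}
      {p p' : ZMod (k + 1)} (hT : IsLabelledUpTo m (AQ :: T))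
      (h : insertResidue (m + 1) (AQ :: T) p = some R)
      (h' : insertResidue (m + 1) [] p' = some R) : False := by
    obtain ⟨A, Q⟩ := AQ
    simp only [insertResidue, Option.some.injEq] at h'
    subst h'
    obtain ⟨hp, hp'⟩ := (exists_label_head_iff hT h).1 ⟨p', by simp⟩
    rw [insertResidue, if_pos hp, if_pos hp'] at h
    simp only [Option.some.injEq, List.cons.injEq, Prod.mk.injEq] at h
    obtain ⟨q, hq⟩ := (hT (A, Q) (by simp)).1
    have h1 : q ∈ ({p'} : Finset (ZMod (k + 1))) := h.1.1 ▸ Finset.mem_insert_of_mem hq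
    have h2 : p ∈ ({p'} : Finset (ZMod (k + 1))) := h.1.1 ▸ Finset.mem_insert_self p A
    rw [Finset.mem_singleton] at h1 h2
    exact hp (by rw [h2, ← h1]; exact hq)

/-- The starting fillings are arbitrary in the induction, so letters are recovered from the last one
back. Equal lengths align the labels. -/
theorem insertLetters_injective {m : ℕ} {T T' R : LabelledFilling k}
    {w w' : List (ZMod (k + 1))} (hT : IsLabelledUpTo m T) (hT' : IsLabelledUpTo m T')
    (hl : w.length = w'.length) (h : insertLetters m T w = some R)
    (h' : insertLetters m T' w' = some R) : T = T' ∧ w = w' := by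
  induction w generalizing m T T' w' with
  | nil =>
    obtain rfl := List.length_eq_zero_iff.1 hl.symm
    simp only [insertLetters, Option.some.injEq] at h h'
    exact ⟨h.trans h'.symm, rfl⟩
  | cons p w ih =>
    cases w' with
    | nil => simp at hl
    | cons p' w' =>
      simp only [insertLetters, Option.bind_eq_some_iff] at h h'
      obtain ⟨U, hU, h⟩ := h
      obtain ⟨U', hU', h'⟩ := h'
      obtain ⟨rfl, rfl⟩ := ih (hT.insertResidue hU) (hT'.insertResidue hU')
        (by simpa using hl) h h'
      obtain ⟨rfl, rfl⟩ := insertResidue_injective hT hT' hU hU'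
      exact ⟨rfl, rfl⟩

theorem insertWord_injective {P : List (Finset (ZMod (k + 1))) × List (RecordingRow k)}
    {w w' : List (ZMod (k + 1))} (hl : w.length = w'.length) (h : insertWord w = some P)
    (h' : insertWord w' = some P) : w = w' := by
  rw [insertWord, Option.map_eq_some_iff] at h h'
  obtain ⟨T, hT, h⟩ := h
  obtain ⟨T', hT', h'⟩ := h'
  have hTT : T = T' := by
    rw [← List.zip_unzip T, ← List.zip_unzip T', h, h']
  subst hTT
  have h0 : IsLabelledUpTo 0 ([] : LabelledFilling k) := by simp [IsLabelledUpTo]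
  exact (insertLetters_injective h0 h0 hl hT hT').2

/-! ### The `k`-code of an affine permutation -/

theorem IsAffinePermutation.exists_inversionCode_eq_zero {x : Equiv.Perm ℤ}
    (hx : IsAffinePermutation k x) : ∃ i, inversionCode k x i = 0 := by
  obtain ⟨w, -, hw⟩ := exists_insertHeights_eq_inversionCode hx
  exact exists_eq_zero_of_insertHeights hw ⟨0, rfl⟩

/-- Maximality plays no role here: among fillings of `k`-codes, being a decomposition already forces
the heights. -/
theorem height_eq_inversionCode {x : Equiv.Perm ℤ} (hx : IsAffinePermutation k x)
    {α : KCode k} (hα : IsCyclicDecomposition k x α.filling) :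
    α.height = inversionCode k x := by
  obtain ⟨-, u, hu, hw⟩ := hα
  rw [isReducedWord_iff hx,
    insertHeights_reverse_flatten (a := α.height) hu] at hw
  exact Option.some.inj hw

theorem isKCodeOf_inversionCode {x : Equiv.Perm ℤ} (hx : IsAffinePermutation k x) :
    IsKCodeOf k ⟨inversionCode k x, hx.exists_inversionCode_eq_zero⟩ x := by
  have hproper := ne_univ_of_mem_fillingOfHeights hx.exists_inversionCode_eq_zero
  obtain ⟨u, hu⟩ := exists_forall₂_isDecreasingWord _ hproper
  refine ⟨⟨hproper, u, hu, ?_⟩, ?_⟩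
  · rw [isReducedWord_iff hx, insertHeights_reverse_flatten hu]
  · rintro B ⟨-, v, hv, hw⟩
    rw [isReducedWord_iff hx] at hw
    exact shape_le_shape_fillingOfHeights hv hw

theorem mainTheorem5 (k : ℕ) [NeZero k] (x : Equiv.Perm ℤ) (hx : IsAffinePermutation k x) :
    (∃! α : KCode k, IsKCodeOf k α x) ∧
      ∀ α : KCode k, IsKCodeOf k α x →
        (∀ w, IsReducedWord k x w → (insertWord w).map Prod.fst = some α.filling) ∧
          Set.BijOn recordingTableau {w | IsReducedWord k x w} (recordingTableaux α) := by
  refine ⟨⟨_, isKCodeOf_inversionCode hx, fun β hβ =>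
    KCode.ext (height_eq_inversionCode hx hβ.1)⟩, fun α hα => ?_⟩
  -- By definition `α.filling` is `fillingOfHeights α.height`.
  have hfill : α.filling = fillingOfHeights (inversionCode k x) :=
    congrArg fillingOfHeights (height_eq_inversionCode hx hα.1)
  have hins : ∀ w, IsReducedWord k x w → (insertWord w).map Prod.fst = some α.filling := by
    intro w hw
    rw [map_fst_insertWord, (isReducedWord_iff hx w).1 hw, hfill]
    rfl
  have hpair : ∀ w, IsReducedWord k x w →
      insertWord w = some (α.filling, recordingTableau w) := by
    intro w hw
    obtain ⟨P, hP, hP'⟩ := Option.map_eq_some_iff.1 (hins w hw)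
    rw [recordingTableau, hP, ← hP']
    rfl
  refine ⟨hins, fun w hw => ⟨w, hpair w hw⟩, fun w hw w' hw' h => ?_, ?_⟩
  · have hl : w.length = w'.length := le_antisymm (hw.2 w' hw'.1) (hw'.2 w hw.1)
    exact insertWord_injective hl (hpair w hw) (by rw [h]; exact hpair w' hw')
  -- A word that inserts to the filling of `α` has the inversion code of `x` as its final heights,
  -- hence is a reduced word for `x`.
  · rintro Q ⟨w, hw⟩
    refine ⟨w, ?_, by simp [recordingTableau, hw]⟩
    have h := map_fst_insertWord w
    rw [hw, hfill, Option.map_some, eq_comm, Option.map_eq_some_iff] at h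
    obtain ⟨a, ha, ha'⟩ := h
    have := fillingOfHeights_injective hx.exists_inversionCode_eq_zero ha'.symm
    exact (isReducedWord_iff hx w).2 (this ▸ ha)

end
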